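/- Let $K$ be an algebraically closed field and let $V$ be a complete algebraic variety over $K$, i.e. a reduced proper $K$-scheme (not necessarily irreducible), identified with its set of $K$-points. For a finite set $E$, a subset of $V^E$ is called an algebraic subvariety if it is Zariski closed in the fibre power $V^E$ over $K$. Let $\mathbb Z$ act on $V^{\mathbb Z}$ by $(gx)(h)=x(h-g)$, and endow $V^{\mathbb Z}$ with the prodiscrete topology (the product topology with each factor $V$ discrete). A configuration $x\in V^{\mathbb Z}$ is periodic if its $\mathbb Z$-orbit is finite. For $\Sigma\subset V^{\mathbb Z}$ and $E\subset\mathbb Z$ put $\Sigma_E=\{x|_E : x\in\Sigma\}$, and let $L(\Sigma)$ be the set of all finite words (including the empty word) over the alphabet $V$ that occur as a block of consecutive letters in some configuration of $\Sigma$. Let $\Sigma\subset V^{\mathbb Z}$ be an algebraic $W$-subshift, that is: 1. (algebraic subshift) $\Sigma$ is shift-invariant, closed in the prodiscrete topology, and $\Sigma_E\subset V^E$ is an algebraic subvariety for every finite $E\subset\mathbb Z$; 2. (irreducible) for all $y,z\in\Sigma$ and all finite $E,F\subset\mathbb Z$ there exist $x\in\Sigma$ and $g\in\mathbb Z$ such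 that $x|_E=y|_E$ and $(gx)|_F=z|_F$; 3. (uniformly bounded fillers) there is an integer $N\ge 0$ such that for every $u\in L(\Sigma)$ there is $c\in L(\Sigma)$ of length $|c|\le N$ with $ucu\in L(\Sigma)$. Then $\Sigma$ contains a dense set of periodic configurations: every configuration of $\Sigma$ lies in the closure, for the prodiscrete topology, of the set of periodic configurations belonging to $\Sigma$. -/

import Mathlib

open CategoryTheory CategoryTheory.Limits AlgebraicGeometry

universe u

namespace AlgSubshift

noncomputable section

/-! ### Symbolic dynamics over `ℤ` with an arbitrary alphabet -/

section Dynamics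

variable {A : Type u}

/-- The shift action of `ℤ` on configurations: `(g x)(h) = x(h - g)`. -/
def shift (g : ℤ) (x : ℤ → A) : ℤ → A := fun h => x (h - g)

/-- A configuration is periodic if its orbit under the shift action is finite. -/
def IsPeriodic (x : ℤ → A) : Prop := (Set.range fun g : ℤ => shift g x).Finite

/-- The prodiscrete topology on `A^ℤ`: the product topology of discrete factors. -/
abbrev prodiscrete (A : Type u) : TopologicalSpace (ℤ → A) :=
  @Pi.topologicalSpace ℤ (fun _ => A) (fun _ => ⊥)

/-- A subshift is a shift-invariant set of configurations (not necessarily closed). -/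
def IsSubshift (S : Set (ℤ → A)) : Prop := ∀ g : ℤ, ∀ x ∈ S, shift g x ∈ S

/-- The restriction `S_E = {x|_E : x ∈ S}` of `S` to `E`. -/
def restrictTo (S : Set (ℤ → A)) (E : Finset ℤ) : Set (E → A) :=
  (fun (x : ℤ → A) (i : E) => x i) '' S

/-- The word `w` occurs in the configuration `x`; the empty word occurs in every configuration. -/
def IsSubword (w : List A) (x : ℤ → A) : Prop :=
  ∃ n : ℤ, ∀ i : Fin w.length, x (n + (i : ℕ)) = w.get i

/-- The language of `S`: all finite words that occur in some configuration of `S`. -/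
def language (S : Set (ℤ → A)) : Set (List A) := {w | ∃ x ∈ S, IsSubword w x}

/-- Irreducibility: for all `y, z ∈ S` and finite `E, F ⊆ ℤ` there are `x ∈ S` and `g ∈ ℤ` with
`x|_E = y|_E` and `(g x)|_F = z|_F`. -/
def IsIrreducibleShift (S : Set (ℤ → A)) : Prop :=
  ∀ y ∈ S, ∀ z ∈ S, ∀ E F : Finset ℤ, ∃ x ∈ S, ∃ g : ℤ,
    (∀ i ∈ E, x i = y i) ∧ (∀ i ∈ F, shift g x i = z i)

/-- A W-subshift: an irreducible subshift with an `N` such that every `u` in the language admits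
some `c` in the language, of length at most `N`, with `ucu` in the language. -/
structure IsWSubshift (S : Set (ℤ → A)) : Prop where
  subshift : IsSubshift S
  irreducible : IsIrreducibleShift S
  filler : ∃ N : ℕ, ∀ u ∈ language S, ∃ c ∈ language S, c.length ≤ N ∧ u ++ c ++ u ∈ language S

end Dynamics

/-! ### Varieties over `K` and their `K`-points -/

section Varieties

variable {K : Type u} [Field K]

/-- The set `V(K)` of `K`-points of a `K`-scheme: morphisms `Spec K ⟶ V` over `Spec K`. -/
abbrev Points (V : Over (Spec (.of K))) : Type u :=
  Over.mk (𝟙 (Spec (.of K))) ⟶ V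

/-- The point of the underlying topological space of `V` hit by a `K`-point. -/
def Points.toPoint {V : Over (Spec (.of K))} (p : Points V) : V.left :=
  p.left (IsLocalRing.closedPoint K)

/-- `V` is a complete algebraic variety over `K`: a reduced `K`-scheme that is proper (in
particular separated and of finite type) over `K`. It may be reducible or empty. -/
structure IsCompleteVariety (V : Over (Spec (.of K))) : Prop where
  isReduced : IsReduced V.left
  isProper : IsProper V.hom

/-- The power `V^E`: the fibre product over `Spec K` of copies of `V` indexed by `E`. -/
abbrev power (V : Over (Spec (.of K))) (E : Finset ℤ) : Over (Spec (.of K)) :=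
  ∏ᶜ fun _ : E => V

/-- The `K`-point of `V^E` with the given coordinates; this is the identification of the set of
functions `E → V(K)` with `V^E(K)`. -/
def powerPoint {V : Over (Spec (.of K))} {E : Finset ℤ} (x : E → Points V) :
    Points (power V E) :=
  Pi.lift x

/-- A set of `K`-points of `V^E` is an algebraic subvariety if it is Zariski closed, i.e. it is the
set of `K`-points lying in some closed subset of the underlying space of the scheme `V^E`. -/
def IsAlgebraicSubvariety {V : Over (Spec (.of K))} {E : Finset ℤ} (Z : Set (E → Points V)) :
    Prop :=
  ∃ C : Set (power V E).left, IsClosed C ∧ Z = {x | (powerPoint x).toPoint ∈ C}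

/-- An algebraic subshift of `V^ℤ`: a prodiscretely closed subshift all of whose restrictions to
finite subsets `E ⊆ ℤ` are algebraic subvarieties of `V^E`. -/
structure IsAlgebraicSubshift {V : Over (Spec (.of K))} (S : Set (ℤ → Points V)) : Prop where
  subshift : IsSubshift S
  closed : @IsClosed _ (prodiscrete (Points V)) S
  algebraic : ∀ E : Finset ℤ, IsAlgebraicSubvariety (restrictTo S E)

end Varieties

end

end AlgSubshift

open scoped Topology

namespace AlgSubshift

noncomputable section

/-! ### Zariski topology on powers of `V` -/

section Zariski

/-! For a word u and a length n, the fillers c ∈ V^n with ucu ∈ L(Σ) form a slice of Σ_{[0,m)}, m =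
2|u| + n, with the outer coordinates frozen, hence a Zariski closed set (`isClosed_fillers`). As V^n
is a Noetherian space, these sets satisfy the descending chain condition. They shrink when u is
replaced by a word having u as both prefix and suffix, so u extends to some v whose fillers of each
length ≤ N shrink no further (`exists_minimal_fillers`). Let c be a filler of v with |c| ≤ N. The
word vcv begins and ends with v, so by minimality c also fills vcv. Iterating puts arbitrarily long
words vcvc⋯cv in L(Σ), and since Σ is closed and shift-invariant it contains the periodic repetition
of vc (`repeatWord_mem`), in which u occurs. -/

theorem overObj_isClosedUnderBinaryProducts {T : Type*} [Category* T] (P : MorphismProperty T)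
    [P.IsStableUnderComposition] [P.IsStableUnderBaseChange] (X : T) :
    (P.overObj (X := X)).IsClosedUnderBinaryProducts where
  limitsOfShape_le := by
    rintro Y ⟨pres, hpres⟩
    let c : BinaryFan (Over.mk (pres.diag.obj ⟨.left⟩).hom) (Over.mk (pres.diag.obj ⟨.right⟩).hom) :=
      (Cone.postcompose (diagramIsoPair pres.diag).hom).obj pres.cone
    have hc : IsLimit c := (IsLimit.postcomposeHomEquiv _ _).symm pres.isLimit
    have hp := IsPullback.of_isLimit (IsLimit.pullbackConeEquivBinaryFanInverse hc)
    -- A product in the slice category is a fibre product, so its first projection is a base change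
    -- of the second structure map.
    have h₁ : P c.fst.left := P.of_isPullback hp.flip (hpres ⟨.right⟩)
    have h₂ : c.fst.left ≫ (pres.diag.obj ⟨.left⟩).hom = Y.hom := Over.w c.fst
    rw [MorphismProperty.overObj_iff, ← h₂]
    exact P.comp_mem _ _ h₁ (hpres ⟨.left⟩)

theorem overObj_isClosedUnderFiniteProducts {T : Type*} [Category* T] [HasFiniteWidePullbacks T]
    (P : MorphismProperty T) [P.IsMultiplicative] [P.IsStableUnderBaseChange] (X : T) :
    (P.overObj (X := X)).IsClosedUnderFiniteProducts :=
  have := overObj_isClosedUnderBinaryProducts P X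
  have := Over.ConstructProducts.over_finiteProducts_of_finiteWidePullbacks (C := T) (B := X)
  .mk'

variable {K : Type u} [Field K]

theorem noetherianSpace_of_isProper (X : Over (Spec (.of K))) [IsProper X.hom] :
    TopologicalSpace.NoetherianSpace X.left := by
  have : IsNoetherianRing (CommRingCat.of K) := inferInstanceAs (IsNoetherianRing K)
  have : IsLocallyNoetherian X.left := LocallyOfFiniteType.isLocallyNoetherian X.hom
  have : CompactSpace X.left := (quasiCompact_iff_compactSpace X.hom).mp inferInstance
  have : IsNoetherian X.left := {}
  infer_instance

variable (V : Over (Spec (.of K)))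

/-- The Zariski topology on the set `V(K)^ι = V^ι(K)`. -/
abbrev zariski (ι : Type) [Finite ι] : TopologicalSpace (ι → Points V) :=
  .induced (fun x => Points.toPoint (V := ∏ᶜ fun _ : ι => V) (Pi.lift x)) inferInstance

variable {V}

theorem isAlgebraicSubvariety_iff {E : Finset ℤ} {Z : Set (E → Points V)} :
    IsAlgebraicSubvariety Z ↔ IsClosed[zariski V E] Z := by
  rw [isClosed_induced_iff]
  exact exists_congr fun C => and_congr_right fun _ => eq_comm

theorem zariski_noetherianSpace (hV : IsProper V.hom) (ι : Type) [Finite ι] :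
    @TopologicalSpace.NoetherianSpace _ (zariski V ι) := by
  have : IsProper (∏ᶜ fun _ : ι => V).hom :=
    have := overObj_isClosedUnderFiniteProducts (T := Scheme.{u}) @IsProper (Spec (.of K))
    (MorphismProperty.overObj (T := Scheme.{u}) @IsProper).prop_product fun _ : ι => hV
  have := noetherianSpace_of_isProper (∏ᶜ fun _ : ι => V)
  let := zariski V ι
  exact Topology.IsInducing.noetherianSpace ⟨rfl⟩

/-- Reindexing coordinates and filling in constants is Zariski continuous. -/
theorem continuous_zariski {ι κ : Type} [Finite ι] [Finite κ] (g : κ → Points V ⊕ ι) :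
    Continuous[zariski V ι, zariski V κ] fun x k => Sum.elim id x (g k) := by
  let φ : (∏ᶜ fun _ : ι => V) ⟶ ∏ᶜ fun _ : κ => V :=
    Pi.lift fun k => Sum.elim (fun p => Over.mkIdTerminal.from _ ≫ p) (Pi.π _) (g k)
  let := zariski V ι
  let := zariski V κ
  refine continuous_induced_rng.2 ?_
  have h : (fun x : κ → Points V => Points.toPoint (V := ∏ᶜ fun _ : κ => V) (Pi.lift x)) ∘
      (fun x k => Sum.elim id x (g k)) =
      φ.left ∘ fun x => Points.toPoint (V := ∏ᶜ fun _ : ι => V) (Pi.lift x) := by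
    funext x
    have hx : (Pi.lift fun k => Sum.elim id x (g k)) = Pi.lift x ≫ φ := by
      refine Pi.hom_ext _ _ fun k => ?_
      rcases hk : g k with p | i
      · simp only [Pi.lift_π, Category.assoc, hk, Sum.elim_inl, id, φ]
        -- A frozen coordinate factors through the terminal object, whose only endomorphism is the
        -- identity.
        rw [← Category.assoc, Over.mkIdTerminal.hom_ext (Pi.lift x ≫ _) (𝟙 _), Category.id_comp]
      · simp [hk, φ]
    simp only [Function.comp, hx, Points.toPoint, Over.comp_left]
    exact Scheme.Hom.comp_apply _ _ _
  rw [h]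
  exact φ.left.continuous.comp continuous_induced_dom

end Zariski

/-! ### Minimal fillers and periodic configurations over any alphabet -/

section Periodic

variable {A : Type u} {S : Set (ℤ → A)}

theorem mem_closure_prodiscrete_iff {T : Set (ℤ → A)} {x : ℤ → A} :
    x ∈ @closure _ (prodiscrete A) T ↔ ∀ E : Finset ℤ, ∃ t ∈ T, ∀ i ∈ E, t i = x i := by
  let : TopologicalSpace A := ⊥
  have : DiscreteTopology A := ⟨rfl⟩
  change x ∈ closure T ↔ _
  rw [mem_closure_iff]
  constructor
  · intro h E
    have ho : IsOpen ((E : Set ℤ).pi fun i => ({x i} : Set A)) :=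
      isOpen_set_pi E.finite_toSet fun _ _ => isOpen_discrete _
    obtain ⟨t, ht, htT⟩ := h _ ho fun i _ => rfl
    exact ⟨t, htT, ht⟩
  · intro h o ho hx
    obtain ⟨E, v, hv, hvo⟩ := isOpen_pi_iff.1 ho x hx
    obtain ⟨t, htT, ht⟩ := h E
    exact ⟨t, hvo fun i hi => by rw [ht i hi]; exact (hv i hi).2, htT⟩

theorem isPeriodic_of_add_eq {x : ℤ → A} {p : ℕ} (hp : 0 < p) (h : ∀ i, x (i + p) = x i) :
    IsPeriodic x := by
  have hper : Function.Periodic x (p : ℤ) := h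
  have hp' : (0 : ℤ) < p := by exact_mod_cast hp
  refine ((Set.finite_Ico (0 : ℤ) p).image fun g => shift g x).subset ?_
  rintro _ ⟨g, rfl⟩
  refine ⟨g % p, ⟨Int.emod_nonneg _ hp'.ne', Int.emod_lt_of_pos _ hp'⟩, ?_⟩
  funext i
  simp only [shift]
  have := hper.sub_int_mul_eq (x := i - g % p) (g / p)
  rw [← this]
  congr 1
  have := Int.emod_add_mul_ediv g p
  simp only [Int.cast_id]
  linarith

theorem isPeriodic_shift {x : ℤ → A} (hx : IsPeriodic x) (g : ℤ) : IsPeriodic (shift g x) := by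
  refine hx.subset ?_
  rintro _ ⟨k, rfl⟩
  exact ⟨g + k, by funext i; simp only [shift]; congr 1; ring⟩

theorem mem_language_of_infix {u v : List A} (h : u <:+: v) (hv : v ∈ language S) :
    u ∈ language S := by
  obtain ⟨s, t, rfl⟩ := h
  obtain ⟨x, hx, n, hn⟩ := hv
  refine ⟨x, hx, n + s.length, fun i => ?_⟩
  have := hn ⟨s.length + i, by simp; omega⟩
  simp only [Nat.cast_add, ← add_assoc] at this
  rw [this]
  simp

theorem mem_language_iff_restrictTo (hS : IsSubshift S) {w : List A} {m : ℕ} (hw : w.length = m)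
    {z : Finset.Ico (0 : ℤ) m → A}
    (hz : ∀ i : Finset.Ico (0 : ℤ) m,
      w[(i : ℤ).toNat]'(by have := Finset.mem_Ico.1 i.2; omega) = z i) :
    w ∈ language S ↔ z ∈ restrictTo S (Finset.Ico (0 : ℤ) m) := by
  subst hw
  obtain rfl := funext hz
  constructor
  · rintro ⟨x, hx, n, hn⟩
    refine ⟨shift (-n) x, hS _ _ hx, ?_⟩
    funext ⟨i, hi⟩
    have hi := Finset.mem_Ico.1 hi
    refine Eq.trans ?_ (hn ⟨i.toNat, by omega⟩)
    simp only [shift]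
    congr 1
    omega
  · rintro ⟨x, hx, h⟩
    refine ⟨x, hx, 0, fun i => ?_⟩
    have := congrFun h ⟨(i : ℕ), by simp⟩
    simpa using this

/-- The fillers of length `n` of `u`. -/
def fillers (S : Set (ℤ → A)) (n : ℕ) (u : List A) : Set (Fin n → A) :=
  {c | u ++ List.ofFn c ++ u ∈ language S}

/-- In vcv, the suffix u of the left v and the prefix u of the right v enclose c. -/
theorem fillers_subset {n : ℕ} {u v : List A} (hp : u <+: v) (hs : u <:+ v) :
    fillers S n v ⊆ fillers S n u := by
  intro c hc
  refine mem_language_of_infix ?_ hc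
  obtain ⟨s, rfl⟩ := hs
  obtain ⟨t, ht⟩ := hp
  refine ⟨s, t, ?_⟩
  nth_rewrite 2 [← ht]
  simp

/-- If the sets of fillers of each given length satisfy the descending chain condition, then each
word extends to one whose sets of short fillers cannot be made smaller. -/
theorem exists_minimal_fillers
    (hwf : ∀ n, (Set.range (fillers S n)).IsWF) {u : List A} (hu : u ∈ language S) (N : ℕ) :
    ∃ v ∈ language S, u <+: v ∧ u <:+ v ∧ ∀ n < N, ∀ w ∈ language S, v <+: w → v <:+ w →
      fillers S n v = fillers S n w := by
  induction N with
  | zero => exact ⟨u, hu, List.prefix_rfl, List.suffix_rfl, by simp⟩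
  | succ N ih =>
    obtain ⟨v, hv, hp, hs, hmin⟩ := ih
    let T : Set (Set (Fin N → A)) := fillers S N '' {w | w ∈ language S ∧ v <+: w ∧ v <:+ w}
    have hT : T.IsWF := (hwf N).mono (Set.image_subset_range _ _)
    obtain ⟨F, hF⟩ := hT.exists_minimal ⟨_, v, ⟨hv, List.prefix_rfl, List.suffix_rfl⟩, rfl⟩
    obtain ⟨⟨w, ⟨hw, hvp, hvs⟩, rfl⟩, hle⟩ := hF
    refine ⟨w, hw, hp.trans hvp, hs.trans hvs, fun n hn z hz hzp hzs => ?_⟩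
    rcases Nat.lt_succ_iff_lt_or_eq.1 hn with hn | rfl
    -- Shorter lengths stay minimal: both w and z extend v.
    · rw [← hmin n hn w hw hvp hvs, hmin n hn z hz (hvp.trans hzp) (hvs.trans hzs)]
    · exact (hle ⟨z, ⟨hz, hvp.trans hzp, hvs.trans hzs⟩, rfl⟩ (fillers_subset hzp hzs)).antisymm
        (fillers_subset hzp hzs)

/-- The bi-infinite repetition of the word `w`. -/
def repeatWord (w : List A) (hw : 0 < w.length) (i : ℤ) : A :=
  w.get ⟨(i % (w.length : ℤ)).toNat, by
    have := Int.emod_nonneg i (b := w.length) (by omega)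
    have := Int.emod_lt_of_pos i (b := w.length) (by omega)
    omega⟩

theorem repeatWord_add {w : List A} (hw : 0 < w.length) (i k : ℤ) :
    repeatWord w hw (i + k * w.length) = repeatWord w hw i := by
  simp only [repeatWord, Int.add_mul_emod_self_right]

theorem repeatWord_natCast {w : List A} (hw : 0 < w.length) {i : ℕ} (hi : i < w.length) :
    repeatWord w hw i = w[i] := by
  have : (i : ℤ) % (w.length : ℤ) = i := Int.emod_eq_of_lt (by omega) (by omega)
  simp [repeatWord, this]

/-- The word `u c u c ⋯ c u` with `2 ^ k` occurrences of `u`. -/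
def iterFill (u c : List A) : ℕ → List A
  | 0 => u
  | k + 1 => iterFill u c k ++ c ++ iterFill u c k

theorem iterFill_prefix (u c : List A) (k : ℕ) : u <+: iterFill u c k := by
  induction k with
  | zero => exact List.prefix_rfl
  | succ k ih => exact ih.trans ⟨_, (List.append_assoc ..).symm⟩

theorem iterFill_suffix (u c : List A) (k : ℕ) : u <:+ iterFill u c k := by
  induction k with
  | zero => exact List.suffix_rfl
  | succ k ih => exact ih.trans ⟨_, rfl⟩

theorem length_iterFill (u c : List A) (k : ℕ) :
    (iterFill u c k).length + c.length = 2 ^ k * (u ++ c).length := by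
  induction k with
  | zero => simp [iterFill]
  | succ k ih =>
    rw [pow_succ, mul_comm _ 2, mul_assoc, ← ih]
    simp [iterFill]
    ring

theorem getElem_iterFill {u c : List A} (h : 0 < (u ++ c).length) (k i : ℕ)
    (hi : i < (iterFill u c k).length) :
    (iterFill u c k)[i] = repeatWord (u ++ c) h i := by
  induction k generalizing i with
  | zero =>
    simp only [iterFill] at hi ⊢
    rw [repeatWord_natCast h (by simp; omega), List.getElem_append_left hi]
  | succ k ih =>
    have hl := length_iterFill u c k
    have hl' : ((iterFill u c k).length : ℤ) + c.length = 2 ^ k * (u ++ c).length := by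
      exact_mod_cast hl
    simp only [iterFill, List.length_append] at hi ⊢
    rcases lt_or_ge i (iterFill u c k).length with h₁ | h₁
    · rw [List.getElem_append_left (by simp; omega), List.getElem_append_left h₁, ih]
    rcases lt_or_ge i ((iterFill u c k).length + c.length) with h₂ | h₂
    · rw [List.getElem_append_left (by simp; omega), List.getElem_append_right h₁]
      -- The last u of `iterFill u c k` starts after 2^k - 1 full periods.
      have : (i : ℤ) = ((u.length + (i - (iterFill u c k).length) : ℕ) : ℤ) +
          (2 ^ k - 1) * (u ++ c).length := by
        rw [sub_mul, ← hl']
        simp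
        omega
      rw [this, repeatWord_add, repeatWord_natCast h (by simp; omega),
        List.getElem_append_right (by omega)]
      simp
    · rw [List.getElem_append_right (by simp; omega), ih]
      have : (i : ℤ) = ((i - (iterFill u c k ++ c).length : ℕ) : ℤ) +
          2 ^ k * (u ++ c).length := by
        rw [← hl']
        simp
        omega
      rw [this, repeatWord_add]

theorem repeatWord_mem (hS : IsSubshift S) (hc : @IsClosed _ (prodiscrete A) S) {u c : List A}
    (h : 0 < (u ++ c).length) (hL : ∀ k, iterFill u c k ∈ language S) :
    repeatWord (u ++ c) h ∈ S := by
  have hcl : @closure _ (prodiscrete A) S = S :=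
    @IsClosed.closure_eq _ (prodiscrete A) _ hc
  rw [← hcl, mem_closure_prodiscrete_iff]
  intro E
  obtain ⟨M, hM⟩ : ∃ M : ℕ, ∀ i ∈ E, i.natAbs ≤ M :=
    ⟨E.sup Int.natAbs, fun i hi => Finset.le_sup (f := Int.natAbs) hi⟩
  set p := (u ++ c).length with hp
  -- With k = 2M + |c| + 1, the length 2^k p - |c| ≥ kp - |c| exceeds 2Mp, so the word covers the
  -- window [-M, M] translated by M periods.
  obtain ⟨x, hx, n, hn⟩ := hL (2 * M + c.length + 1)
  have hlen := length_iterFill u c (2 * M + c.length + 1)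
  rw [← hp] at hlen
  have h₃ : 2 * M + c.length + 1 ≤ 2 ^ (2 * M + c.length + 1) :=
    Nat.lt_two_pow_self.le
  have h₄ := Nat.mul_le_mul_right p h₃
  refine ⟨shift (-(n + M * p)) x, hS _ _ hx, fun i hi => ?_⟩
  have hi := hM i hi
  have hMp : M ≤ M * p := Nat.le_mul_of_pos_right M h
  have hcp : c.length ≤ c.length * p := Nat.le_mul_of_pos_right _ h
  have hj : (i + M * p : ℤ) = ((i + M * p : ℤ).toNat : ℕ) := by
    have : (M : ℤ) ≤ M * p := by exact_mod_cast hMp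
    omega
  have hlt : (i + M * p : ℤ).toNat < (iterFill u c (2 * M + c.length + 1)).length := by
    have : (2 * M + c.length + 1) * p = 2 * (M * p) + c.length * p + p := by ring
    have : ((M * p : ℕ) : ℤ) = (M : ℤ) * p := Nat.cast_mul _ _
    omega
  have hx' := hn ⟨_, hlt⟩
  rw [List.get_eq_getElem, getElem_iterFill h] at hx'
  dsimp only at hx'
  rw [← hj, repeatWord_add] at hx'
  rw [← hx', shift]
  congr 1
  ring

theorem dense_periodic (hS : IsSubshift S) (hc : @IsClosed _ (prodiscrete A) S) {N : ℕ}
    (hN : ∀ u ∈ language S, ∃ c ∈ language S, c.length ≤ N ∧ u ++ c ++ u ∈ language S)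
    (hwf : ∀ n, (Set.range (fillers S n)).IsWF) :
    S ⊆ @closure _ (prodiscrete A) {x | x ∈ S ∧ IsPeriodic x} := by
  intro y hy
  rw [mem_closure_prodiscrete_iff]
  intro E
  obtain ⟨M, hM⟩ : ∃ M : ℕ, ∀ i ∈ E, i.natAbs ≤ M :=
    ⟨E.sup Int.natAbs, fun i hi => Finset.le_sup (f := Int.natAbs) hi⟩
  -- The block of y on [-M, M]; being nonempty, it makes the period |vc| positive even if c is
  -- empty.
  let u : List A := List.ofFn fun i : Fin (2 * M + 1) => y (i - M)
  have hul : u.length = 2 * M + 1 := List.length_ofFn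
  have hu : u ∈ language S :=
    ⟨y, hy, -M, fun i => by simp only [u, List.get_ofFn]; congr 1; simp; ring⟩
  obtain ⟨v, hv, hp, -, hmin⟩ := exists_minimal_fillers hwf hu (N + 1)
  obtain ⟨c, -, hcN, hc'⟩ := hN v hv
  have hvl : u.length ≤ v.length := hp.length_le
  have hpos : 0 < (v ++ c).length := by simp; omega
  have hL : ∀ k, iterFill v c k ∈ language S := by
    intro k
    induction k with
    | zero => exact hv
    | succ k ih =>
      have : c.get ∈ fillers S c.length v := by
        simpa only [fillers, Set.mem_ofPred_eq, List.ofFn_get] using hc'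
      -- Minimality of v transfers the filler c from v to the longer word.
      rw [hmin c.length (by omega) _ ih (iterFill_prefix v c k) (iterFill_suffix v c k)] at this
      simpa only [fillers, Set.mem_ofPred_eq, List.ofFn_get, iterFill] using this
  refine ⟨shift (-M) (repeatWord (v ++ c) hpos),
    ⟨hS _ _ (repeatWord_mem hS hc hpos hL), isPeriodic_shift (isPeriodic_of_add_eq hpos fun i => ?_)
      _⟩, fun i hi => ?_⟩
  · simpa using repeatWord_add hpos i 1
  · have := hM i hi
    have hi' : i - -(M : ℤ) = ((i + M).toNat : ℕ) := by omega
    have hlt : (i + M).toNat < u.length := by omega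
    rw [shift, hi', repeatWord_natCast hpos (by simp; omega),
      List.getElem_append_left (by omega), ← hp.getElem hlt]
    simp only [u, List.getElem_ofFn]
    congr 1
    omega

end Periodic

/-! ### Chain condition for fillers in algebraic subshifts -/

section Main

variable {K : Type u} [Field K] {V : Over (Spec (.of K))} {S : Set (ℤ → Points V)}

theorem isClosed_fillers (hS : IsAlgebraicSubshift S) (n : ℕ) (u : List (Points V)) :
    IsClosed[zariski V (Fin n)] (fillers S n u) := by
  let m := u.length + n + u.length
  -- The map c ↦ ucu in coordinates: constants on the two copies of u, variables in between.
  let g : Finset.Ico (0 : ℤ) m → Points V ⊕ Fin n := fun i =>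
    if h₁ : (i : ℤ).toNat < u.length then .inl u[(i : ℤ).toNat] else
    if h₂ : (i : ℤ).toNat < u.length + n then .inr ⟨(i : ℤ).toNat - u.length, by omega⟩ else
      .inl (u[(i : ℤ).toNat - u.length - n]'(by have := Finset.mem_Ico.1 i.2; omega))
  have hcl := isAlgebraicSubvariety_iff.1 (hS.algebraic (Finset.Ico (0 : ℤ) m))
  have hpre := @IsClosed.preimage _ _ (zariski V (Fin n)) (zariski V _) _
    (continuous_zariski g) _ hcl
  convert! hpre using 1
  ext c
  have hlen : (u ++ List.ofFn c ++ u).length = m := by simp [m, add_assoc]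
  refine mem_language_iff_restrictTo hS.subshift hlen fun i => ?_
  have hi := Finset.mem_Ico.1 i.2
  change _ = Sum.elim id c (dite _ _ _)
  split_ifs with h₁ h₂
  · rw [List.getElem_append_left (by simp; omega), List.getElem_append_left h₁]
    rfl
  · rw [List.getElem_append_left (by simp; omega), List.getElem_append_right (by omega)]
    simp
  · rw [List.getElem_append_right (by simp; omega)]
    simp [Nat.sub_sub]

theorem isWF_range_fillers (hV : IsProper V.hom) (hS : IsAlgebraicSubshift S) (n : ℕ) :
    (Set.range (fillers S n)).IsWF := by
  let := zariski V (Fin n)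
  have := zariski_noetherianSpace hV (Fin n)
  have hwf : WellFounded fun s t : TopologicalSpace.Closeds (Fin n → Points V) => s < t :=
    wellFounded_lt
  rw [Set.IsWF, Set.wellFoundedOn_range]
  let f : List (Points V) → TopologicalSpace.Closeds (Fin n → Points V) :=
    fun u => ⟨fillers S n u, isClosed_fillers hS n u⟩
  exact InvImage.wf f hwf

end Main

end

end AlgSubshift

theorem mainTheorem10 {K : Type u} [Field K] [IsAlgClosed K]
    (V : Over (Spec (.of K))) (hV : AlgSubshift.IsCompleteVariety V)
    (S : Set (ℤ → AlgSubshift.Points V))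
    (hS : AlgSubshift.IsAlgebraicSubshift S) (hW : AlgSubshift.IsWSubshift S) :
    S ⊆ @closure _ (AlgSubshift.prodiscrete (AlgSubshift.Points V))
      {x | x ∈ S ∧ AlgSubshift.IsPeriodic x} := by
  obtain ⟨N, hN⟩ := hW.filler
  exact AlgSubshift.dense_periodic hS.subshift hS.closed hN
    (AlgSubshift.isWF_range_fillers hV.isProper hS)
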